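/- \textbf{Conventions.} Let $\mathcal R$ be a monoid with unit group $W$ and set of idempotents $E(\mathcal R)$. For $e,f\in E(\mathcal R)$ write $e\le f$ if $ef=fe=e$. The monoid $\mathcal R$ is \emph{factorizable} if $\mathcal R=E(\mathcal R)W=WE(\mathcal R)$ and the idempotents commute (so that $E(\mathcal R)$ is a meet semilattice with meet $ef$, and $\mathcal R$ is an inverse monoid). If $(W,S)$ is a Coxeter system, $\le$ on $W$ denotes the Bruhat order, $W_I$ (for $I\subseteq S$) the subgroup generated by $I$, and ${}^IW$ (resp. $W^I$) the set of $u\in W$ that are the Bruhat minimum of $W_Iu$ (resp. $uW_I$). For an idempotent $e$ put $$\lambda(e)=\{s\in S: se=es\},\quad \lambda_*(e)=\{s\in S: se=es=e\},\quad \lambda^*(e)=\{s\in S: se=es\neq e\}.$$ A triple $(\mathcal R,\Lambda,S)$ is a \emph{Renner-Coxeter system}, and $\mathcal R$ a \emph{Renner-Coxeter monoid}, if: (i) $\mathcal R$ is factorizable; (ii) $\Lambda\subseteq E(\mathcal R)$ is a transversal for the conjugation action of $W$ on $E(\mathcal R)$ and is closed under meets; (iii) $(W,S)$ is a Coxeter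 system; (iv) for all $e\le e'$ in $E(\mathcal R)$ there are $w\in W$ and $f\le f'$ in $\Lambda$ with $wew^{-1}=f$ and $we'w^{-1}=f'$; (v) for $e\le f$ in $\Lambda$, $\lambda^*(e)\subseteq\lambda^*(f)$; (vi) for every $e\in\Lambda$ the groups $\{w\in W: we=ew\}$ and $\{w\in W: we=ew=e\}$ are of the form $W_I$ with $I\subseteq S$. Every $r\in\mathcal R$ then has a unique \emph{left standard form} $r=xey$ with $e\in\Lambda$, $x\in W^{\lambda_*(e)}$, $y\in{}^{\lambda(e)}W$. For $r=xey$ and $s=afb$ in left standard form, the \emph{adherence order} is defined by: $r\le^+s$ iff $e\le f$ and there is $w\in W_{\lambda^*(f)}W_{\lambda_*(e)}$ with $x\le aw$ and $w^{-1}b\le y$. Green's relations are: $r\,\mathscr J\,s$ iff $\mathcal Rr\mathcal R=\mathcal Rs\mathcal R$; $r\,\mathscr L\,s$ iff $\mathcal Rr=\mathcal Rs$; $r\,\mathscr R\,s$ iff $r\mathcal R=s\mathcal R$. \textbf{Proposition.} Let $(\mathcal R,\Lambda,S)$ be a Renner-Coxeter system with $\mathcal R$ finite, and let $r,s\in\mathcal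 R$ satisfy $r\,\mathscr J\,s$ and $r\le^+s$. Then there exist $t,u\in\mathcal R$ such that $r\le^+t\le^+s$, $r\le^+u\le^+s$, $r\,\mathscr R\,t\,\mathscr L\,s$ and $r\,\mathscr L\,u\,\mathscr R\,s$. -/

import Mathlib

/-! ### Bruhat order and minimal coset representatives -/

section Coxeter

variable {B W : Type*} [Group W] {M : CoxeterMatrix B}

/-- The Bruhat order of a Coxeter system: `u ≤ v` iff some reduced word for `v` has a subword
(not necessarily contiguous) which is a reduced word for `u`. -/
def bruhatLE (cs : CoxeterSystem M W) (u v : W) : Prop :=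
  ∃ ω ω' : List B, cs.IsReduced ω ∧ cs.wordProd ω = v ∧
    cs.IsReduced ω' ∧ cs.wordProd ω' = u ∧ ω'.Sublist ω

/-- The standard parabolic subgroup `W_I` generated by the simple reflections in `I`. -/
def parabolic (cs : CoxeterSystem M W) (I : Set B) : Subgroup W :=
  Subgroup.closure (cs.simple '' I)

/-- `^I W ^J`: the elements which are the minimum, for the Bruhat order, of their double coset
`W_I u W_J`. -/
def minReps (cs : CoxeterSystem M W) (I J : Set B) : Set W :=
  {u | ∀ v ∈ DoubleCoset.doubleCoset u (parabolic cs I : Set W) (parabolic cs J : Set W),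
    bruhatLE cs u v}

end Coxeter

/-! ### Idempotents, factorizable monoids, Green's relations -/

section Monoid

variable {R : Type*} [Monoid R]

/-- The natural order on idempotents: `e ≤ f` iff `e f = f e = e`. -/
def idemLE (e f : R) : Prop := e * f = e ∧ f * e = e

/-- Factorizable monoid: unit regular, `R = E(R) G(R) = G(R) E(R)`, and the idempotents form a
meet semilattice, the meet of `e` and `f` being their product (i.e. idempotents commute; together
with unit regularity this is what makes `R` an inverse monoid). -/
structure IsFactorizable (R : Type*) [Monoid R] : Prop where
  exists_idem_mul_unit : ∀ r : R, ∃ (e : R) (w : Rˣ), IsIdempotentElem e ∧ r = e * w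
  exists_unit_mul_idem : ∀ r : R, ∃ (w : Rˣ) (e : R), IsIdempotentElem e ∧ r = w * e
  idem_comm : ∀ e f : R, IsIdempotentElem e → IsIdempotentElem f → e * f = f * e

/-- In a factorizable monoid the product of two idempotents is an idempotent, and it is their
greatest lower bound for the natural order. -/
theorem IsFactorizable.mul_isMeet (h : IsFactorizable R) {e f : R}
    (he : IsIdempotentElem e) (hf : IsIdempotentElem f) :
    IsIdempotentElem (e * f) ∧ idemLE (e * f) e ∧ idemLE (e * f) f ∧
      ∀ g : R, IsIdempotentElem g → idemLE g e → idemLE g f → idemLE g (e * f) := by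
  have hc : e * f = f * e := h.idem_comm e f he hf
  have hee : e * e = e := he
  have hff : f * f = f := hf
  refine ⟨he.mul_of_commute hc hf, ⟨?_, ?_⟩, ⟨?_, ?_⟩, fun g _ hge hgf => ⟨?_, ?_⟩⟩
  · rw [hc, mul_assoc, hee]
  · rw [← mul_assoc, hee]
  · rw [mul_assoc, hff]
  · rw [hc, ← mul_assoc, hff]
  · rw [← mul_assoc, hge.1, hgf.1]
  · rw [mul_assoc, hgf.2, hge.2]

/-- Green's relation `J`: `R r R = R s R`. -/
def greenJ (r s : R) : Prop :=
  {x : R | ∃ a b : R, x = a * r * b} = {x : R | ∃ a b : R, x = a * s * b}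

/-- Green's relation `L`: `R r = R s`. -/
def greenL (r s : R) : Prop := {x : R | ∃ a : R, x = a * r} = {x : R | ∃ a : R, x = a * s}

/-- Green's relation `R`: `r R = s R`. -/
def greenR (r s : R) : Prop := {x : R | ∃ b : R, x = r * b} = {x : R | ∃ b : R, x = s * b}

end Monoid

/-! ### Renner-Coxeter systems and the adherence order -/

section RennerCoxeter

variable {B R : Type*} [Monoid R] {M : CoxeterMatrix B}

/-- The type map `λ(e) = {s ∈ S | s e = e s}`. -/
def typeMap (cs : CoxeterSystem M Rˣ) (e : R) : Set B :=
  {i | (cs.simple i : R) * e = e * (cs.simple i : R)}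

/-- The lower type map `λ_*(e) = {s ∈ S | s e = e s = e}`. -/
def lowerType (cs : CoxeterSystem M Rˣ) (e : R) : Set B :=
  {i | (cs.simple i : R) * e = e * (cs.simple i : R) ∧ (cs.simple i : R) * e = e}

/-- The upper type map `λ^*(e) = {s ∈ S | s e = e s ≠ e}`. -/
def upperType (cs : CoxeterSystem M Rˣ) (e : R) : Set B :=
  {i | (cs.simple i : R) * e = e * (cs.simple i : R) ∧ (cs.simple i : R) * e ≠ e}

/-- `(R, Λ, S)` is a (generalized) Renner-Coxeter system, where `cs` is the Coxeter system
`(W, S)` on the unit group `W = Rˣ` of `R`, with `S = {cs.simple i}`. -/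
structure IsRennerCoxeterSystem (cs : CoxeterSystem M Rˣ) (Λ : Set R) : Prop where
  factorizable : IsFactorizable R
  idem : ∀ e ∈ Λ, IsIdempotentElem e
  transversal : ∀ e : R, IsIdempotentElem e →
    ∃! f : R, f ∈ Λ ∧ ∃ w : Rˣ, (w : R) * e * ((w⁻¹ : Rˣ) : R) = f
  meet_mem : ∀ e ∈ Λ, ∀ f ∈ Λ, e * f ∈ Λ
  exists_conj : ∀ e e' : R, IsIdempotentElem e → IsIdempotentElem e' → idemLE e e' →
    ∃ w : Rˣ, ∃ f ∈ Λ, ∃ f' ∈ Λ, idemLE f f' ∧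
      (w : R) * e * ((w⁻¹ : Rˣ) : R) = f ∧ (w : R) * e' * ((w⁻¹ : Rˣ) : R) = f'
  upperType_mono : ∀ e ∈ Λ, ∀ f ∈ Λ, idemLE e f → upperType cs e ⊆ upperType cs f
  centralizer_parabolic : ∀ e ∈ Λ, ∃ I : Set B,
    {w : Rˣ | (w : R) * e = e * (w : R)} = (parabolic cs I : Set Rˣ)
  stabilizer_parabolic : ∀ e ∈ Λ, ∃ I : Set B,
    {w : Rˣ | (w : R) * e = e * (w : R) ∧ (w : R) * e = e} = (parabolic cs I : Set Rˣ)

/-- `r = x e y` is the left standard form of `r`: `e ∈ Λ`, `x ∈ W^{λ_*(e)}`, `y ∈ ^{λ(e)}W`. -/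
def IsLeftStandardForm (cs : CoxeterSystem M Rˣ) (Λ : Set R) (r : R) (x : Rˣ) (e : R) (y : Rˣ) :
    Prop :=
  r = (x : R) * e * (y : R) ∧ e ∈ Λ ∧
    x ∈ minReps cs ∅ (lowerType cs e) ∧ y ∈ minReps cs (typeMap cs e) ∅

/-- The adherence order `≤⁺`: if `r = x e y` and `s = a f b` in left standard form, then
`r ≤⁺ s` iff `e ≤ f` and there is `w ∈ W_{λ^*(f)} W_{λ_*(e)}` with `x ≤ a w` and `w⁻¹ b ≤ y`. -/
def adherenceLE (cs : CoxeterSystem M Rˣ) (Λ : Set R) (r s : R) : Prop :=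
  ∃ (x : Rˣ) (e : R) (y : Rˣ) (a : Rˣ) (f : R) (b : Rˣ),
    IsLeftStandardForm cs Λ r x e y ∧ IsLeftStandardForm cs Λ s a f b ∧ idemLE e f ∧
    ∃ w : Rˣ, (∃ p ∈ parabolic cs (upperType cs f), ∃ q ∈ parabolic cs (lowerType cs e),
        w = p * q) ∧
      bruhatLE cs x (a * w) ∧ bruhatLE cs (w⁻¹ * b) y

end RennerCoxeter

/-! ### The strong exchange property -/

namespace CoxeterSystem

variable {B W : Type*} [Group W] {M : CoxeterMatrix B} (cs : CoxeterSystem M W)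

/-! Write r = xey and s = afb. In a finite monoid, comparable idempotents in the same 𝒥-class
coincide (`idemLE.eq_of_mul_mul_eq`), so e = f, and the adherence witness is w = pq with p in
W_{λ^*(e)} and q in W_{λ_*(e)}. The generators in λ^*(e) commute with those in λ_*(e)
(`IsRennerCoxeterSystem.simple_commute`), so multiplication by W_{λ^*(e)} preserves minimality for
W_{λ_*(e)}. Minimality of x and of p⁻¹b then removes q, leaving x ≤ ap and p⁻¹b ≤ y.

The element u = (ap)ey is now between r and s, and it is ℛ-related to s because p commutes with e.
For t the factor must be moved to the side of x: `exists_mul_bruhatLE` turns x ≤ ap into xv ≤ a with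
v in W_{λ^*(e)} and vb ≤ p⁻¹b ≤ y, and t = (xv)eb works.

The Bruhat arguments need transitivity and the lifting properties, which are not visible from the
subword definition. They are proved for chains of reflections (`BruhatStep.lower_upper`) and carried
over by `bruhatLE_iff_bruhatChain`. The underlying tool is the strong exchange property, obtained
from an action of W on W × ℤ/2 that records the parity of inversions. -/

open Classical in
/-- The action of a simple reflection on `W × ℤ/2`: it conjugates the first coordinate, and flips
the sign exactly when the first coordinate is that reflection. -/
noncomputable def signedConj (i : B) : Function.End (W × ZMod 2) :=
  fun p => (cs.simple i * p.1 * cs.simple i, p.2 + if p.1 = cs.simple i then 1 else 0)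

open Classical in
theorem signedConj_mul_pow (i j : B) (m : ℕ) (t : W) (ε : ZMod 2) :
    ((cs.signedConj i * cs.signedConj j) ^ m) (t, ε) =
      ((cs.simple i * cs.simple j) ^ m * t * ((cs.simple i * cs.simple j) ^ m)⁻¹,
        ε + ∑ k ∈ Finset.range (2 * m),
          if t = cs.simple j * (cs.simple i * cs.simple j) ^ k then 1 else 0) := by
  set c := cs.simple i * cs.simple j with hc
  have hcinv : c⁻¹ = cs.simple j * cs.simple i := by simp [hc]
  have hsc : cs.simple j * c * cs.simple j = c⁻¹ := by simp [hc, mul_assoc]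
  have hsck : ∀ k : ℕ, cs.simple j * c ^ k * cs.simple j = (c ^ k)⁻¹ := by
    intro k
    have h := conj_pow (i := k) (a := cs.simple j) (b := c)
    rw [cs.inv_simple, hsc, inv_pow] at h
    exact h.symm
  have hflip : ∀ k : ℕ, (c ^ k)⁻¹ * cs.simple j = cs.simple j * c ^ k := by
    intro k
    rw [← hsck, cs.simple_mul_simple_cancel_right]
  induction m with
  | zero => simp; rfl
  | succ m ih =>
    rw [pow_succ']
    change cs.signedConj i (cs.signedConj j (((cs.signedConj i * cs.signedConj j) ^ m) (t, ε))) = _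
    rw [ih]
    -- One more factor c performs two sign tests, one per letter; they are the summands of index 2m
    -- and 2m + 1.
    have h1 : (c ^ m * t * (c ^ m)⁻¹ = cs.simple j) ↔ t = cs.simple j * c ^ (2 * m) := by
      rw [two_mul, pow_add, ← mul_assoc, ← hflip, mul_inv_eq_iff_eq_mul, mul_assoc,
        eq_inv_mul_iff_mul_eq]
    have h2 : (cs.simple j * (c ^ m * t * (c ^ m)⁻¹) * cs.simple j = cs.simple i) ↔
        t = cs.simple j * c ^ (2 * m + 1) := by
      have : cs.simple j * c ^ (2 * m + 1) =
          (c ^ m)⁻¹ * (cs.simple j * cs.simple i * cs.simple j) * c ^ m := by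
        rw [show 2 * m + 1 = m + 1 + m by ring, pow_add, pow_succ]
        simp only [← mul_assoc]
        rw [hflip]
        simp [hc, mul_assoc]
      rw [this]
      constructor
      · intro h
        rw [← h]
        simp [mul_assoc]
      · intro h
        rw [h]
        simp [mul_assoc]
    simp only [signedConj, h1, h2]
    rw [show 2 * (m + 1) = 2 * m + 1 + 1 by ring, Finset.sum_range_succ, Finset.sum_range_succ]
    refine Prod.ext ?_ ?_
    · simp [pow_succ', hc, mul_assoc]
    · simp [add_assoc]

/-- For m = `M i j` the product s_i s_j has trivial m-th power, so the sign tests of index k and k +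
m agree and cancel in pairs in ℤ/2. -/
theorem signedConj_isLiftable : M.IsLiftable cs.signedConj := by
  classical
  intro i j
  funext ⟨t, ε⟩
  rw [signedConj_mul_pow, cs.simple_mul_simple_pow, two_mul, Finset.sum_range_add]
  simp only [pow_add, cs.simple_mul_simple_pow, one_mul]
  rw [CharTwo.add_self_eq_zero]
  simp
  rfl

/-- The action of `W` on `W × ℤ/2` extending `signedConj`. -/
noncomputable def signedConjHom : W →* Function.End (W × ZMod 2) :=
  cs.lift ⟨cs.signedConj, cs.signedConj_isLiftable⟩

theorem signedConjHom_simple (i : B) : cs.signedConjHom (cs.simple i) = cs.signedConj i :=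
  cs.lift_apply_simple cs.signedConj_isLiftable i

open Classical in
theorem signedConjHom_wordProd (ω : List B) (t : W) (ε : ZMod 2) :
    cs.signedConjHom (cs.wordProd ω) (t, ε) =
      (cs.wordProd ω * t * (cs.wordProd ω)⁻¹, ε + ((cs.rightInvSeq ω).count t : ZMod 2)) := by
  induction ω with
  | nil => simp; rfl
  | cons i ω ih =>
    rw [cs.wordProd_cons, map_mul, signedConjHom_simple]
    change cs.signedConj i (cs.signedConjHom (cs.wordProd ω) (t, ε)) = _
    rw [ih]
    have h : (cs.wordProd ω * t * (cs.wordProd ω)⁻¹ = cs.simple i) ↔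
        (cs.wordProd ω)⁻¹ * cs.simple i * cs.wordProd ω = t := by
      rw [mul_inv_eq_iff_eq_mul, mul_assoc, inv_mul_eq_iff_eq_mul, eq_comm]
    simp only [signedConj, rightInvSeq, List.count_cons, h, beq_iff_eq]
    refine Prod.ext ?_ ?_
    · simp [mul_assoc]
    · simp [add_assoc]

/-- The parity of the number of occurrences of `t` in the right inversion sequence of any word
for `w`. -/
noncomputable def invParity (w t : W) : ZMod 2 := (cs.signedConjHom w (t, 0)).2

open Classical in
theorem invParity_wordProd (ω : List B) (t : W) :
    cs.invParity (cs.wordProd ω) t = ((cs.rightInvSeq ω).count t : ZMod 2) := by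
  simp [invParity, signedConjHom_wordProd]

theorem signedConjHom_apply (w t : W) (ε : ZMod 2) :
    cs.signedConjHom w (t, ε) = (w * t * w⁻¹, ε + cs.invParity w t) := by
  obtain ⟨ω, rfl⟩ := cs.wordProd_surjective w
  rw [invParity_wordProd, signedConjHom_wordProd]

/-- The cocycle rule, read off from the second coordinate of the action. -/
theorem invParity_mul (w w' t : W) :
    cs.invParity (w * w') t = cs.invParity w' t + cs.invParity w (w' * t * w'⁻¹) := by
  have h : cs.signedConjHom (w * w') (t, 0) = cs.signedConjHom w (cs.signedConjHom w' (t, 0)) := by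
    rw [map_mul]; rfl
  rw [invParity, h, signedConjHom_apply, signedConjHom_apply]
  simp

theorem invParity_one (t : W) : cs.invParity 1 t = 0 := by
  rw [invParity, map_one]
  rfl

open Classical in
theorem invParity_simple (i : B) (t : W) :
    cs.invParity (cs.simple i) t = if t = cs.simple i then 1 else 0 := by
  simp [invParity, signedConjHom_simple, signedConj]

/-- For t = w s w⁻¹ the cocycle rule leaves the contribution 1 of s at itself; those of w and w⁻¹
sum to the parity of w w⁻¹ = 1, which is 0. -/
theorem IsReflection.invParity_self {t : W} (ht : cs.IsReflection t) : cs.invParity t t = 1 := by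
  obtain ⟨w, i, rfl⟩ := ht
  have h := cs.invParity_mul w w⁻¹ (w * cs.simple i * w⁻¹)
  rw [mul_inv_cancel, invParity_one] at h
  rw [invParity_mul, invParity_mul]
  simp only [inv_inv, mul_assoc, inv_mul_cancel_left, inv_mul_cancel, mul_one, one_mul,
    cs.simple_mul_simple_self, cs.inv_simple, invParity_simple, if_true] at h ⊢
  linear_combination -h

theorem lt_of_invParity_eq_one {w t : W} (h : cs.invParity w t = 1) :
    cs.length (w * t) < cs.length w := by
  classical
  obtain ⟨ω, hω, rfl⟩ := cs.exists_isReduced w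
  rw [invParity_wordProd] at h
  have hmem : t ∈ cs.rightInvSeq ω := by
    by_contra hn
    rw [List.count_eq_zero_of_not_mem hn] at h
    simp at h
  exact (cs.isRightInversion_of_mem_rightInvSeq hω hmem).2

theorem IsReflection.invParity_eq_one_iff {t : W} (ht : cs.IsReflection t) (w : W) :
    cs.invParity w t = 1 ↔ cs.length (w * t) < cs.length w := by
  refine ⟨cs.lt_of_invParity_eq_one, fun h => ?_⟩
  by_contra hn
  have h0 : cs.invParity w t = 0 := by
    revert hn
    generalize cs.invParity w t = z
    revert z
    decide
  -- If w had parity 0 at t, then wt would have parity 1, so (wt)t = w would be shorter than wt.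
  have h1 : cs.invParity (w * t) t = 1 := by
    rw [invParity_mul, IsReflection.invParity_self cs ht, mul_inv_cancel_right, h0, add_zero]
  have h2 := cs.lt_of_invParity_eq_one h1
  rw [mul_assoc, ht.mul_self, mul_one] at h2
  omega

/-- The strong exchange property. -/
theorem IsReflection.exists_eraseIdx {t : W} (ht : cs.IsReflection t) {ω : List B}
    (h : cs.length (cs.wordProd ω * t) < cs.length (cs.wordProd ω)) :
    ∃ j < ω.length, cs.wordProd ω * t = cs.wordProd (ω.eraseIdx j) := by
  classical
  rw [← IsReflection.invParity_eq_one_iff cs ht, invParity_wordProd] at h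
  have hmem : t ∈ cs.rightInvSeq ω := by
    by_contra hn
    rw [List.count_eq_zero_of_not_mem hn] at h
    simp at h
  obtain ⟨j, hj, rfl⟩ := List.mem_iff_getElem.1 hmem
  refine ⟨j, by simpa using hj, ?_⟩
  rw [← cs.wordProd_mul_getD_rightInvSeq, List.getD_eq_getElem _ _ hj]

/-- If deleting one letter from `ω₁ ++ ω₂` is what right multiplication by `t` does, the letter is
deleted from one of the two factors. -/
theorem IsReflection.exchange_mul {t : W} (ht : cs.IsReflection t) {u v : W}
    (h : cs.length (u * v * t) < cs.length (u * v)) :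
    (∃ u', cs.length u' < cs.length u ∧ u * v * t = u' * v) ∨
      ∃ v', cs.length v' < cs.length v ∧ u * v * t = u * v' := by
  obtain ⟨ω₁, h₁, rfl⟩ := cs.exists_isReduced u
  obtain ⟨ω₂, h₂, rfl⟩ := cs.exists_isReduced v
  rw [← cs.wordProd_append] at h
  obtain ⟨j, hj, he⟩ := IsReflection.exists_eraseIdx cs ht h
  rw [List.length_append] at hj
  rw [cs.wordProd_append] at he
  rcases lt_or_ge j ω₁.length with hlt | hge
  · left
    rw [List.eraseIdx_append_of_lt_length hlt, cs.wordProd_append] at he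
    refine ⟨_, ?_, he⟩
    have := cs.length_wordProd_le (ω₁.eraseIdx j)
    rw [List.length_eraseIdx_of_lt hlt] at this
    rw [h₁.eq]; omega
  · right
    rw [List.eraseIdx_append_of_length_le hge, cs.wordProd_append] at he
    refine ⟨_, ?_, he⟩
    have := cs.length_wordProd_le (ω₂.eraseIdx (j - ω₁.length))
    rw [List.length_eraseIdx_of_lt (by omega)] at this
    rw [h₂.eq]; omega

/-- Otherwise s t s is a right inversion of u⁻¹s. As s t s ≠ s, the factor s contributes no parity,
so t would be a right inversion of u⁻¹, against u < tu. -/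
theorem IsReflection.length_simple_mul_lt {t : W} (ht : cs.IsReflection t) {i : B}
    (hti : t ≠ cs.simple i) {u : W} (h : cs.length u < cs.length (t * u)) :
    cs.length (cs.simple i * u) < cs.length (cs.simple i * (t * u)) := by
  have hr : cs.IsReflection (cs.simple i * t * cs.simple i) := by
    simpa using ht.conj (cs.simple i)
  have hne := hr.length_mul_right_ne (cs.simple i * u)
  have he : cs.simple i * t * cs.simple i * (cs.simple i * u) = cs.simple i * (t * u) := by
    simp [mul_assoc]
  rw [he] at hne
  by_contra hn
  have hlt : cs.length (u⁻¹ * cs.simple i * (cs.simple i * t * cs.simple i)) <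
      cs.length (u⁻¹ * cs.simple i) := by
    rw [← cs.length_inv, ← cs.length_inv (u⁻¹ * _)]
    simp only [mul_inv_rev, inv_inv, cs.inv_simple, ht.inv]
    simp only [mul_assoc, cs.simple_mul_simple_cancel_left]
    omega
  rw [← IsReflection.invParity_eq_one_iff cs hr, invParity_mul, invParity_simple, if_neg] at hlt
  · simp only [cs.inv_simple, ← mul_assoc, cs.simple_mul_simple_cancel_right,
      cs.simple_mul_simple_self, one_mul, zero_add] at hlt
    rw [IsReflection.invParity_eq_one_iff cs ht, ← cs.length_inv, ← cs.length_inv u⁻¹] at hlt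
    simp only [mul_inv_rev, inv_inv, ht.inv] at hlt
    omega
  · intro heq
    apply hti
    have := congrArg (fun z => cs.simple i * z * cs.simple i) heq
    simpa [mul_assoc] using this

end CoxeterSystem

/-! ### The Bruhat order -/

namespace CoxeterSystem

variable {B W : Type*} [Group W] {M : CoxeterMatrix B} (cs : CoxeterSystem M W)

/-- An edge of the Bruhat graph. -/
def BruhatStep (u v : W) : Prop := cs.IsReflection (v * u⁻¹) ∧ cs.length u < cs.length v

/-- The reflexive transitive closure of the Bruhat graph. -/
def BruhatChain : W → W → Prop := Relation.ReflTransGen cs.BruhatStep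

/-- The smaller one of `w` and `s w`. -/
noncomputable def lower (i : B) (w : W) : W :=
  if cs.length (cs.simple i * w) < cs.length w then cs.simple i * w else w

/-- The larger one of `w` and `s w`. -/
noncomputable def upper (i : B) (w : W) : W :=
  if cs.length (cs.simple i * w) < cs.length w then w else cs.simple i * w

theorem bruhatStep_simple_mul {i : B} {w : W} (h : cs.length w < cs.length (cs.simple i * w)) :
    cs.BruhatStep w (cs.simple i * w) :=
  ⟨by simpa using cs.isReflection_simple i, h⟩

theorem bruhatStep_of_simple_mul_lt {i : B} {w : W}
    (h : cs.length (cs.simple i * w) < cs.length w) : cs.BruhatStep (cs.simple i * w) w :=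
  ⟨by simpa using cs.isReflection_simple i, h⟩

theorem bruhatChain_lower (i : B) (w : W) : cs.BruhatChain (cs.lower i w) w := by
  unfold lower
  split_ifs with h
  · exact .single (cs.bruhatStep_of_simple_mul_lt h)
  · exact .refl

theorem bruhatChain_upper (i : B) (w : W) : cs.BruhatChain w (cs.upper i w) := by
  unfold upper
  split_ifs with h
  · exact .refl
  · exact .single (cs.bruhatStep_simple_mul
      (lt_of_le_of_ne (not_lt.1 h) (cs.length_simple_mul_ne w i).symm))

theorem lower_simple_mul (i : B) (w : W) : cs.lower i (cs.simple i * w) = cs.lower i w := by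
  have := cs.length_simple_mul_ne w i
  unfold lower
  rw [cs.simple_mul_simple_cancel_left]
  split_ifs <;> first | rfl | omega

theorem upper_simple_mul (i : B) (w : W) : cs.upper i (cs.simple i * w) = cs.upper i w := by
  have := cs.length_simple_mul_ne w i
  unfold upper
  rw [cs.simple_mul_simple_cancel_left]
  split_ifs <;> first | rfl | omega

variable {cs}

/-- Monotonicity of w ↦ min(w, sw) and w ↦ max(w, sw) contains every lifting property. If the step
is by s itself, both ends have the same min and max; otherwise conjugation by s turns the edge u → v
into an edge su → sv whenever the lengths allow it. -/
theorem BruhatStep.lower_upper {u v : W} (h : cs.BruhatStep u v) (i : B) :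
    cs.BruhatChain (cs.lower i u) (cs.lower i v) ∧
      cs.BruhatChain (cs.upper i u) (cs.upper i v) := by
  obtain ⟨ht, hl⟩ := h
  by_cases hti : v * u⁻¹ = cs.simple i
  · obtain rfl : v = cs.simple i * u := by rw [← hti]; simp
    rw [lower_simple_mul, upper_simple_mul]
    exact ⟨.refl, .refl⟩
  have hne := cs.length_simple_mul_ne u i
  have hstep : cs.BruhatStep u v := ⟨ht, hl⟩
  have hr : cs.IsReflection (cs.simple i * v * (cs.simple i * u)⁻¹) := by
    simpa [mul_assoc] using ht.conj (cs.simple i)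
  by_cases hu : cs.length (cs.simple i * u) < cs.length u
  · have hu' := cs.bruhatStep_of_simple_mul_lt hu
    refine ⟨?_, ?_⟩
    · rw [lower, if_pos hu, lower]
      split_ifs with hv
      · refine .single ⟨hr, ?_⟩
        rcases cs.length_simple_mul u i with h | h <;> rcases cs.length_simple_mul v i with h' | h'
          <;> omega
      · exact .tail (.single hu') hstep
    · rw [upper, if_pos hu]
      exact (Relation.ReflTransGen.single hstep).trans (cs.bruhatChain_upper i v)
  · have hlt := IsReflection.length_simple_mul_lt cs ht hti (u := u) (by simpa using hl)
    rw [inv_mul_cancel_right] at hlt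
    have hsv : cs.BruhatStep (cs.simple i * u) (cs.simple i * v) := ⟨hr, hlt⟩
    refine ⟨?_, ?_⟩
    · rw [lower, if_neg hu, lower]
      split_ifs with hv
      · exact .tail (.single (cs.bruhatStep_simple_mul (by omega))) hsv
      · exact .single hstep
    · rw [upper, if_neg hu]
      refine (Relation.ReflTransGen.single hsv).trans ?_
      rw [← cs.upper_simple_mul]
      exact cs.bruhatChain_upper i _

theorem BruhatChain.lower {u v : W} (h : cs.BruhatChain u v) (i : B) :
    cs.BruhatChain (cs.lower i u) (cs.lower i v) := by
  induction h with
  | refl => exact .refl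
  | tail _ h ih => exact ih.trans (h.lower_upper i).1

theorem BruhatChain.upper {u v : W} (h : cs.BruhatChain u v) (i : B) :
    cs.BruhatChain (cs.upper i u) (cs.upper i v) := by
  induction h with
  | refl => exact .refl
  | tail _ h ih => exact ih.trans (h.lower_upper i).2

theorem bruhatChain_one {u : W} (h : cs.BruhatChain u 1) : u = 1 := by
  rcases Relation.ReflTransGen.cases_tail h with h | ⟨v, _, hv⟩
  · exact h.symm
  · have := hv.2
    simp at this

theorem BruhatChain.exists_reduced_sublist {ω : List B} {u : W}
    (h : cs.BruhatChain u (cs.wordProd ω)) :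
    ∃ ω', cs.IsReduced ω' ∧ cs.wordProd ω' = u ∧ ω'.Sublist ω := by
  induction ω generalizing u with
  | nil =>
    rw [cs.wordProd_nil] at h
    obtain rfl := bruhatChain_one h
    exact ⟨[], by simp [IsReduced], by simp, List.Sublist.refl _⟩
  | cons i ω ih =>
    rw [cs.wordProd_cons] at h
    -- The tail of the word treats min(u, su); the letter `i` is put back exactly when it is a left
    -- descent of u. The word itself need not be reduced.
    have h' := h.lower i
    rw [lower_simple_mul] at h'
    obtain ⟨ω', hr, hp, hs⟩ := ih (h'.trans (cs.bruhatChain_lower i _))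
    by_cases hu : cs.length (cs.simple i * u) < cs.length u
    · rw [CoxeterSystem.lower, if_pos hu] at hp
      have hp' : cs.wordProd (i :: ω') = u := by
        rw [cs.wordProd_cons, hp, cs.simple_mul_simple_cancel_left]
      refine ⟨i :: ω', ?_, hp', hs.cons_cons i⟩
      rw [IsReduced, hp', List.length_cons, ← hr.eq, hp]
      rcases cs.length_simple_mul u i with h | h <;> omega
    · rw [CoxeterSystem.lower, if_neg hu] at hp
      exact ⟨ω', hr, hp, hs.cons i⟩

theorem bruhatChain_of_sublist {ω' ω : List B} (h : ω'.Sublist ω) (hω : cs.IsReduced ω) :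
    cs.BruhatChain (cs.wordProd ω') (cs.wordProd ω) := by
  induction h with
  | slnil => exact .refl
  | @cons l₁ l₂ i _ ih =>
    have hr : cs.IsReduced l₂ := hω.drop 1
    rw [cs.wordProd_cons]
    refine (ih hr).trans (.single (cs.bruhatStep_simple_mul ?_))
    rw [← cs.wordProd_cons, hω.eq, hr.eq, List.length_cons]
    omega
  | @cons_cons l₁ l₂ i _ ih =>
    have hr : cs.IsReduced l₂ := hω.drop 1
    have h := (ih hr).upper i
    have h₁ : cs.BruhatChain (cs.simple i * cs.wordProd l₁) (cs.upper i (cs.wordProd l₁)) := by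
      rw [← upper_simple_mul]
      exact cs.bruhatChain_upper i _
    have h₂ : cs.upper i (cs.wordProd l₂) = cs.simple i * cs.wordProd l₂ := by
      rw [CoxeterSystem.upper, if_neg]
      rw [← cs.wordProd_cons, hω.eq, hr.eq, List.length_cons]
      omega
    rw [cs.wordProd_cons, cs.wordProd_cons, ← h₂]
    exact h₁.trans h

/-- The subword property. -/
theorem bruhatLE_iff_bruhatChain {u v : W} : bruhatLE cs u v ↔ cs.BruhatChain u v := by
  constructor
  · rintro ⟨ω, ω', hω, rfl, -, rfl, hs⟩
    exact bruhatChain_of_sublist hs hω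
  · intro h
    obtain ⟨ω, hω, rfl⟩ := cs.exists_isReduced v
    obtain ⟨ω', hr, hp, hs⟩ := h.exists_reduced_sublist
    exact ⟨ω, ω', hω, rfl, hr, hp, hs⟩

end CoxeterSystem

open CoxeterSystem

/-! ### Order and lifting properties in terms of subwords -/

section Bruhat

variable {B W : Type*} [Group W] {M : CoxeterMatrix B} {cs : CoxeterSystem M W}

theorem bruhatLE_refl (u : W) : bruhatLE cs u u := bruhatLE_iff_bruhatChain.2 .refl

theorem bruhatLE.trans {u v w : W} (h : bruhatLE cs u v) (h' : bruhatLE cs v w) :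
    bruhatLE cs u w :=
  bruhatLE_iff_bruhatChain.2
    ((bruhatLE_iff_bruhatChain.1 h).trans (bruhatLE_iff_bruhatChain.1 h'))

theorem bruhatLE.length_le {u v : W} (h : bruhatLE cs u v) : cs.length u ≤ cs.length v := by
  obtain ⟨ω, ω', hω, rfl, hω', rfl, hs⟩ := h
  rw [hω.eq, hω'.eq]
  exact hs.length_le

theorem bruhatLE.inv {u v : W} (h : bruhatLE cs u v) : bruhatLE cs u⁻¹ v⁻¹ := by
  obtain ⟨ω, ω', hω, rfl, hω', rfl, hs⟩ := h
  exact ⟨ω.reverse, ω'.reverse, hω.reverse, cs.wordProd_reverse ω, hω'.reverse,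
    cs.wordProd_reverse ω', hs.reverse⟩

theorem bruhatLE_simple_mul {i : B} {w : W} (h : cs.length w < cs.length (cs.simple i * w)) :
    bruhatLE cs w (cs.simple i * w) :=
  bruhatLE_iff_bruhatChain.2 (.single (cs.bruhatStep_simple_mul h))

/-- The lifting property: if `u < s u`, then `u ≤ v` implies `u ≤ s v`. -/
theorem bruhatLE.le_simple_mul {i : B} {u v : W} (h : bruhatLE cs u v)
    (hu : cs.length u < cs.length (cs.simple i * u)) : bruhatLE cs u (cs.simple i * v) := by
  rw [bruhatLE_iff_bruhatChain] at h ⊢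
  have h' := h.lower i
  rw [CoxeterSystem.lower, if_neg hu.not_gt, ← lower_simple_mul] at h'
  exact h'.trans (cs.bruhatChain_lower i _)

/-- The lifting property: if `s u < u`, then `u ≤ v` implies `s u ≤ s v`. -/
theorem bruhatLE.simple_mul_le {i : B} {u v : W} (h : bruhatLE cs u v)
    (hu : cs.length (cs.simple i * u) < cs.length u) :
    bruhatLE cs (cs.simple i * u) (cs.simple i * v) := by
  rw [bruhatLE_iff_bruhatChain] at h ⊢
  have h' := h.lower i
  rw [CoxeterSystem.lower, if_pos hu, ← lower_simple_mul cs i v] at h'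
  exact h'.trans (cs.bruhatChain_lower i _)

/-- The lifting property: if `v < s v`, then `u ≤ v` implies `s u ≤ s v`. -/
theorem bruhatLE.simple_mul_le_of_lt {i : B} {u v : W} (h : bruhatLE cs u v)
    (hv : cs.length v < cs.length (cs.simple i * v)) :
    bruhatLE cs (cs.simple i * u) (cs.simple i * v) := by
  rw [bruhatLE_iff_bruhatChain] at h ⊢
  have h' := h.upper i
  rw [← upper_simple_mul, CoxeterSystem.upper.eq_def cs i v, if_neg hv.not_gt] at h'
  exact (cs.bruhatChain_upper i _).trans h'

theorem length_inv_mul_simple (i : B) (u : W) :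
    cs.length (cs.simple i * u⁻¹) = cs.length (u * cs.simple i) := by
  rw [← cs.length_inv]
  simp

theorem bruhatLE.le_mul_simple {i : B} {u v : W} (h : bruhatLE cs u v)
    (hu : cs.length u < cs.length (u * cs.simple i)) : bruhatLE cs u (v * cs.simple i) := by
  have h' := (h.inv.le_simple_mul (i := i) (by rwa [length_inv_mul_simple, cs.length_inv])).inv
  simpa using h'

theorem bruhatLE.mul_simple_le {i : B} {u v : W} (h : bruhatLE cs u v)
    (hu : cs.length (u * cs.simple i) < cs.length u) :
    bruhatLE cs (u * cs.simple i) (v * cs.simple i) := by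
  have h' := (h.inv.simple_mul_le (i := i) (by rwa [length_inv_mul_simple, cs.length_inv])).inv
  simpa using h'

/-! ### Minimal coset representatives -/

/-- Lifting is applied one generator at a time, so comparison with the generators alone already
gives the Bruhat minimum of the coset. -/
theorem bruhatLE_mul_of_mem_parabolic {I : Set B} {u w : W}
    (hu : ∀ i ∈ I, cs.length u < cs.length (u * cs.simple i)) (hw : w ∈ parabolic cs I) :
    bruhatLE cs u (u * w) := by
  induction hw using Subgroup.closure_induction_right with
  | one => simpa using bruhatLE_refl u
  | mul_right x _ y hy ih =>
    obtain ⟨i, hi, rfl⟩ := hy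
    rw [← mul_assoc]
    exact ih.le_mul_simple (hu i hi)
  | mul_inv_cancel x _ y hy ih =>
    obtain ⟨i, hi, rfl⟩ := hy
    rw [cs.inv_simple, ← mul_assoc]
    exact ih.le_mul_simple (hu i hi)

theorem parabolic_empty : parabolic cs (∅ : Set B) = ⊥ := by
  simp [parabolic]

theorem simple_mem_parabolic {I : Set B} {i : B} (hi : i ∈ I) : cs.simple i ∈ parabolic cs I :=
  Subgroup.subset_closure ⟨i, hi, rfl⟩

theorem mem_minReps_empty_left {I : Set B} {u : W} :
    u ∈ minReps cs ∅ I ↔ ∀ i ∈ I, cs.length u < cs.length (u * cs.simple i) := by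
  constructor
  · intro h i hi
    have := h (u * cs.simple i) (DoubleCoset.mem_doubleCoset.2
      ⟨1, one_mem _, _, simple_mem_parabolic hi, by simp⟩)
    exact lt_of_le_of_ne this.length_le (cs.length_mul_simple_ne u i).symm
  · intro h v hv
    obtain ⟨x, hx, y, hy, rfl⟩ := DoubleCoset.mem_doubleCoset.1 hv
    rw [parabolic_empty] at hx
    obtain rfl : x = 1 := by simpa using hx
    rw [one_mul]
    exact bruhatLE_mul_of_mem_parabolic h hy

theorem mem_minReps_empty_right {I : Set B} {u : W} :
    u ∈ minReps cs I ∅ ↔ ∀ i ∈ I, cs.length u < cs.length (cs.simple i * u) := by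
  constructor
  · intro h i hi
    have := h (cs.simple i * u) (DoubleCoset.mem_doubleCoset.2
      ⟨_, simple_mem_parabolic hi, 1, one_mem _, by simp⟩)
    exact lt_of_le_of_ne this.length_le (cs.length_simple_mul_ne u i).symm
  · intro h v hv
    obtain ⟨x, hx, y, hy, rfl⟩ := DoubleCoset.mem_doubleCoset.1 hv
    rw [parabolic_empty] at hy
    obtain rfl : y = 1 := by simpa using hy
    have h' := bruhatLE_mul_of_mem_parabolic (cs := cs) (u := u⁻¹) (w := x⁻¹) (I := I)
      (fun i hi => by
        rw [cs.length_inv, ← cs.length_inv (u⁻¹ * _)]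
        simpa using h i hi) (inv_mem hx)
    simpa using h'.inv

theorem bruhatLE_mul_left_of_mem_parabolic {I : Set B} {u w : W}
    (hu : ∀ i ∈ I, cs.length u < cs.length (cs.simple i * u)) (hw : w ∈ parabolic cs I) :
    bruhatLE cs u (w * u) :=
  mem_minReps_empty_right.2 hu _ (DoubleCoset.mem_doubleCoset.2 ⟨w, hw, 1, one_mem _, by simp⟩)

theorem exists_rightDescent_of_mem_parabolic {I : Set B} {w : W} (hw : w ∈ parabolic cs I)
    (h1 : w ≠ 1) : ∃ i ∈ I, cs.length (w * cs.simple i) < cs.length w := by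
  by_contra! hn
  -- Without a descent in I, w would be the minimum of w W_I = W_I, hence below w w⁻¹ = 1.
  have h := bruhatLE_mul_of_mem_parabolic (cs := cs) (u := w)
    (fun i hi => lt_of_le_of_ne (hn i hi) (cs.length_mul_simple_ne w i).symm) (inv_mem hw)
  have := h.length_le
  rw [mul_inv_cancel, cs.length_one] at this
  exact h1 (cs.length_eq_zero_iff.1 (by omega))

/-- Left multiplication by a left-minimal coset representative reflects left descents. -/
theorem length_mul_lt_simple_mul_mul {I : Set B} {b w : W} {i : B}
    (hb : ∀ i ∈ I, cs.length b < cs.length (cs.simple i * b)) (hw : w ∈ parabolic cs I)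
    (hi : i ∈ I) (h : cs.length w < cs.length (cs.simple i * w)) :
    cs.length (w * b) < cs.length (cs.simple i * (w * b)) := by
  refine lt_of_le_of_ne (not_lt.1 fun hn => ?_) (cs.length_simple_mul_ne _ i).symm
  have hn' : cs.length (b⁻¹ * w⁻¹ * cs.simple i) < cs.length (b⁻¹ * w⁻¹) := by
    rw [← cs.length_inv, ← cs.length_inv (b⁻¹ * w⁻¹)]
    simpa using hn
  -- A letter lost from b⁻¹ would give an element of W_I b shorter than b; a letter lost from w⁻¹
  -- would make s_i a left descent of w.
  rcases IsReflection.exchange_mul cs (cs.isReflection_simple i) hn' with ⟨b', hb', he⟩ | ⟨w', hw', he⟩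
  · have hb'' : b'⁻¹ = w⁻¹ * cs.simple i * w * b := by
      rw [← inv_inj, inv_inv, ← mul_inv_eq_iff_eq_mul.2 he]
      simp [mul_assoc]
    have := (bruhatLE_mul_left_of_mem_parabolic hb
      (mul_mem (mul_mem (inv_mem hw) (simple_mem_parabolic hi)) hw)).length_le
    rw [← hb'', cs.length_inv, ← cs.length_inv b] at this
    omega
  · rw [mul_assoc, mul_left_cancel_iff] at he
    rw [← he, ← cs.length_inv, ← cs.length_inv w⁻¹] at hw'
    simp only [mul_inv_rev, inv_inv, cs.inv_simple] at hw'
    omega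

/-- If `x ≤ a p` with `p ∈ W_I`, then some `x v ≤ a` with `v ∈ W_I` below `p⁻¹`, as seen in the
coset of a minimal representative `b` of `W_I b`. -/
theorem exists_mul_bruhatLE {I : Set B} {b : W}
    (hb : ∀ i ∈ I, cs.length b < cs.length (cs.simple i * b)) {p : W} (hp : p ∈ parabolic cs I)
    {x a : W} (h : bruhatLE cs x (a * p)) :
    ∃ v ∈ parabolic cs I, bruhatLE cs (x * v) a ∧ bruhatLE cs (v * b) (p⁻¹ * b) := by
  induction hn : cs.length p using Nat.strong_induction_on generalizing p x with
  | _ n ih =>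
  by_cases h1 : p = 1
  · subst h1
    exact ⟨1, one_mem _, by simpa using h, by simpa using bruhatLE_refl b⟩
  obtain ⟨i, hi, hd⟩ := exists_rightDescent_of_mem_parabolic hp h1
  obtain ⟨q, rfl⟩ : ∃ q, p = q * cs.simple i := ⟨p * cs.simple i, by simp⟩
  rw [cs.simple_mul_simple_cancel_right] at hd
  have hq : q ∈ parabolic cs I := by
    simpa using mul_mem hp (simple_mem_parabolic hi)
  rw [← mul_assoc] at h
  have hup := length_mul_lt_simple_mul_mul hb (inv_mem hq) hi
    (by rwa [length_inv_mul_simple, cs.length_inv])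
  rw [mul_inv_rev, cs.inv_simple, mul_assoc]
  -- The last letter s of p = qs is peeled off. If xs < x, then xs ≤ aq and s is prepended to the
  -- inductive v; if x < xs, then x ≤ aq and v is kept. In both cases q⁻¹b < s q⁻¹b = p⁻¹b gives the
  -- second bound.
  rcases lt_or_gt_of_ne (cs.length_mul_simple_ne x i) with hx | hx
  · have h' := h.mul_simple_le hx
    rw [cs.simple_mul_simple_cancel_right] at h'
    obtain ⟨v, hv, hxv, hvb⟩ := ih _ (hn ▸ hd) hq h' rfl
    refine ⟨cs.simple i * v, mul_mem (simple_mem_parabolic hi) hv, by rwa [← mul_assoc], ?_⟩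
    rw [mul_assoc]
    exact hvb.simple_mul_le_of_lt hup
  · have h' := h.le_mul_simple hx
    rw [cs.simple_mul_simple_cancel_right] at h'
    obtain ⟨v, hv, hxv, hvb⟩ := ih _ (hn ▸ hd) hq h' rfl
    exact ⟨v, hv, hxv, hvb.trans (bruhatLE_simple_mul hup)⟩

/-- If `x` has no right descent in `I` and `x ≤ z q` with `q ∈ W_I`, then `x ≤ z`. -/
theorem bruhatLE_of_le_mul {I : Set B} {x z q : W}
    (hx : ∀ i ∈ I, cs.length x < cs.length (x * cs.simple i)) (hq : q ∈ parabolic cs I)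
    (h : bruhatLE cs x (z * q)) : bruhatLE cs x z := by
  induction hq using Subgroup.closure_induction_right with
  | one => simpa using h
  | mul_right q' _ y hy ih =>
    obtain ⟨i, hi, rfl⟩ := hy
    refine ih ?_
    simpa [mul_assoc] using h.le_mul_simple (hx i hi)
  | mul_inv_cancel q' _ y hy ih =>
    obtain ⟨i, hi, rfl⟩ := hy
    refine ih ?_
    simpa [mul_assoc] using h.le_mul_simple (hx i hi)

/-- The condition of having no left descents in `J` is stable under left multiplication by `W_I`
when the generators in `I` and `J` are distinct and commute. -/
theorem length_lt_simple_mul_of_commute {I J : Set B}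
    (hc : ∀ i ∈ I, ∀ j ∈ J, cs.simple i * cs.simple j = cs.simple j * cs.simple i)
    (hne : ∀ i ∈ I, ∀ j ∈ J, cs.simple i ≠ cs.simple j) {w u : W} (hw : w ∈ parabolic cs I)
    (hu : ∀ j ∈ J, cs.length u < cs.length (cs.simple j * u)) :
    ∀ j ∈ J, cs.length (w * u) < cs.length (cs.simple j * (w * u)) := by
  have key : ∀ i ∈ I, ∀ v : W, (∀ j ∈ J, cs.length v < cs.length (cs.simple j * v)) →
      ∀ j ∈ J, cs.length (cs.simple i * v) < cs.length (cs.simple j * (cs.simple i * v)) := by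
    intro i hi v hv j hj
    have h := IsReflection.length_simple_mul_lt cs (cs.isReflection_simple j)
      (hne i hi j hj).symm (hv j hj)
    rwa [← mul_assoc, hc i hi j hj, mul_assoc] at h
  induction hw using Subgroup.closure_induction_left with
  | one => simpa using hu
  | mul_left y hy w' _ ih =>
    obtain ⟨i, hi, rfl⟩ := hy
    rw [mul_assoc]
    exact key i hi _ ih
  | inv_mul_cancel y hy w' _ ih =>
    obtain ⟨i, hi, rfl⟩ := hy
    rw [cs.inv_simple, mul_assoc]
    exact key i hi _ ih

theorem length_lt_mul_simple_of_commute {I J : Set B}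
    (hc : ∀ i ∈ I, ∀ j ∈ J, cs.simple i * cs.simple j = cs.simple j * cs.simple i)
    (hne : ∀ i ∈ I, ∀ j ∈ J, cs.simple i ≠ cs.simple j) {w u : W} (hw : w ∈ parabolic cs I)
    (hu : ∀ j ∈ J, cs.length u < cs.length (u * cs.simple j)) :
    ∀ j ∈ J, cs.length (u * w) < cs.length (u * w * cs.simple j) := by
  intro j hj
  have h := length_lt_simple_mul_of_commute hc hne (u := u⁻¹) (inv_mem hw)
    (fun j hj => by rw [length_inv_mul_simple, cs.length_inv]; exact hu j hj) j hj
  rwa [← mul_inv_rev, length_inv_mul_simple, cs.length_inv] at h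

/-- A simple reflection outside `W_I` which conjugates a simple reflection of `W_I` into `W_I`
commutes with it. -/
theorem simple_commute_of_conj_mem_parabolic {I : Set B} {i j : B}
    (hi : cs.simple i ∉ parabolic cs I) (hj : cs.simple j ∈ parabolic cs I)
    (h : cs.simple i * cs.simple j * cs.simple i ∈ parabolic cs I) :
    cs.simple i * cs.simple j = cs.simple j * cs.simple i := by
  have hne : cs.simple i * cs.simple j * cs.simple i ≠ 1 := by
    intro h1
    have := congrArg cs.length (mul_eq_one_iff_eq_inv.1 h1)
    have := cs.length_simple_mul (cs.simple j) i
    rw [cs.length_simple] at this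
    simp only [cs.inv_simple, cs.length_simple] at *
    omega
  have hij : cs.simple i * cs.simple j ≠ 1 := by
    intro h1
    rw [mul_eq_one_iff_eq_inv, cs.inv_simple] at h1
    exact hi (h1 ▸ hj)
  obtain ⟨k, hk, hd⟩ := exists_rightDescent_of_mem_parabolic h hne
  have hk' := simple_mem_parabolic (cs := cs) hk
  have hsk := mul_mem h hk'
  have hw : cs.simple i * cs.simple j * cs.simple i = cs.wordProd [i, j, i] := by
    simp [wordProd, mul_assoc]
  rw [hw] at hd hsk
  -- Deleting an outer letter of s_i s_j s_i would put s_i in W_I. So the middle letter goes and s_i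
  -- s_j s_i = s_k has length 1; a second exchange, in s_i s_j, then forces s_i s_j s_i = s_j.
  obtain ⟨n, hn, he⟩ := IsReflection.exists_eraseIdx cs (cs.isReflection_simple k) hd
  rw [he] at hsk
  simp only [List.length_cons, List.length_nil] at hn
  have hone : cs.length (cs.simple i * cs.simple j * cs.simple i) = 1 := by
    interval_cases n
    · refine absurd ?_ hi
      have : cs.simple j * cs.simple i ∈ parabolic cs I := by simpa [wordProd] using hsk
      exact (Subgroup.mul_mem_cancel_left _ hj).1 this
    · have : cs.simple i * cs.simple j * cs.simple i * cs.simple k = 1 := by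
        rw [hw, he]; simp [wordProd]
      rw [mul_eq_one_iff_eq_inv.1 this, cs.inv_simple, cs.length_simple]
    · refine absurd ?_ hi
      have : cs.simple i * cs.simple j ∈ parabolic cs I := by simpa [wordProd] using hsk
      exact (Subgroup.mul_mem_cancel_right _ hj).1 this
  have hw' : cs.simple i * cs.simple j = cs.wordProd [i, j] := by simp [wordProd]
  have hd' : cs.length (cs.wordProd [i, j] * cs.simple i) < cs.length (cs.wordProd [i, j]) := by
    rw [← hw', hone]
    have h0 : cs.length (cs.simple i * cs.simple j) ≠ 0 := fun h0 =>
      hij (cs.length_eq_zero_iff.1 h0)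
    have := cs.length_simple_mul (cs.simple j) i
    rw [cs.length_simple] at this
    omega
  obtain ⟨n, hn, he⟩ := IsReflection.exists_eraseIdx cs (cs.isReflection_simple i) hd'
  simp only [List.length_cons, List.length_nil] at hn
  rw [← hw'] at he
  interval_cases n
  · have : cs.simple i * cs.simple j * cs.simple i = cs.simple j := by simpa [wordProd] using he
    nth_rewrite 2 [← this]
    simp
  · refine absurd (mul_right_cancel (b := cs.simple i) ?_) hij
    simpa [wordProd] using he

end Bruhat

/-! ### Renner-Coxeter systems -/

theorem exists_isIdempotentElem_pow {R : Type*} [Monoid R] [Finite R] (c : R) :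
    ∃ n, IsIdempotentElem (c ^ (n + 1)) := by
  obtain ⟨m, n, hmn, h⟩ : ∃ m n : ℕ, m < n ∧ c ^ m = c ^ n := by
    obtain ⟨m, n, hne, h⟩ := Finite.exists_ne_map_eq_of_infinite (fun n : ℕ => c ^ n)
    rcases lt_or_gt_of_ne hne with hlt | hlt
    · exact ⟨m, n, hlt, h⟩
    · exact ⟨n, m, hlt, h.symm⟩
  obtain ⟨d, rfl⟩ : ∃ d, n = m + d + 1 := ⟨n - m - 1, by omega⟩
  have hk : ∀ k l, c ^ (m + l) = c ^ (m + l + k * (d + 1)) := by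
    intro k
    induction k with
    | zero => simp
    | succ k ih =>
      intro l
      rw [ih, show m + l + k * (d + 1) = m + (l + k * (d + 1)) by ring, pow_add, h, ← pow_add]
      ring_nf
  -- The exponent (m + 1)(d + 1) is a multiple of the period d + 1 and lies beyond the preperiod m,
  -- so doubling it does not change the power.
  refine ⟨(m + 1) * (d + 1) - 1, ?_⟩
  have hpos : 0 < (m + 1) * (d + 1) := by positivity
  have hm : m ≤ (m + 1) * (d + 1) := by nlinarith
  rw [Nat.sub_add_cancel hpos, IsIdempotentElem, ← pow_add]
  obtain ⟨l, hl⟩ := Nat.exists_eq_add_of_le hm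
  have := hk (m + 1) l
  rw [← hl] at this
  exact this.symm

/-- In a finite monoid, comparable idempotents in the same two-sided class are equal. -/
theorem idemLE.eq_of_mul_mul_eq {R : Type*} [Monoid R] [Finite R] {e f : R}
    (hle : idemLE e f) (he : IsIdempotentElem e) {p q : R} (h : p * e * q = f) : e = f := by
  have hstep : ∀ n : ℕ, (p * e) ^ n * f * q ^ n = f := by
    intro n
    induction n with
    | zero => simp
    | succ n ih =>
      have h1 : (p * e) * f * q = f := by rw [mul_assoc p, hle.1, h]
      calc (p * e) ^ (n + 1) * f * q ^ (n + 1)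
          = (p * e) ^ n * ((p * e) * f * q) * q ^ n := by
            rw [pow_succ, pow_succ']; simp only [mul_assoc]
        _ = f := by rw [h1, ih]
  -- An idempotent power g of pe satisfies gf = f by the iterated identity and ge = g by
  -- construction. Hence g = g(ef) = gf = f, and ge = g reads fe = f.
  obtain ⟨n, hn⟩ := exists_isIdempotentElem_pow (p * e)
  have hgf : (p * e) ^ (n + 1) * f = f := by
    conv_lhs => rw [← hstep (n + 1)]
    simp only [← mul_assoc]
    rw [hn.eq]
    exact hstep (n + 1)
  have hge : (p * e) ^ (n + 1) * e = (p * e) ^ (n + 1) := by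
    rw [pow_succ, mul_assoc, mul_assoc p, he.eq]
  have h1 : (p * e) ^ (n + 1) = f := by
    calc (p * e) ^ (n + 1) = (p * e) ^ (n + 1) * (e * f) := by rw [hle.1, hge]
      _ = f := by rw [← mul_assoc, hge, hgf]
  rw [h1] at hge
  exact hle.2.symm.trans hge

/-! ### Commutation with idempotents and Green's relations -/

section RennerCoxeter

variable {B R : Type*} [Monoid R] {M : CoxeterMatrix B} {cs : CoxeterSystem M Rˣ} {Λ : Set R}

theorem commute_of_mem_parabolic_upperType {e : R} {w : Rˣ}
    (hw : w ∈ parabolic cs (upperType cs e)) : (w : R) * e = e * w := by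
  induction hw using Subgroup.closure_induction with
  | mem x hx => obtain ⟨i, hi, rfl⟩ := hx; exact hi.1
  | one => simp
  | mul x y _ _ hx hy => rw [Units.val_mul, mul_assoc, hy, ← mul_assoc, hx, mul_assoc]
  | inv x _ hx => exact (Commute.units_inv_left (a := e) hx).eq

theorem simple_ne_of_mem_upperType {e : R} {i j : B} (hi : i ∈ upperType cs e)
    (hj : j ∈ lowerType cs e) : cs.simple i ≠ cs.simple j := fun h => hi.2 (h ▸ hj.2)

/-- Since s_i commutes with e, the conjugate s_i s_j s_i again fixes e, while s_i does not. The
fixing group is parabolic, so `simple_commute_of_conj_mem_parabolic` applies. -/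
theorem IsRennerCoxeterSystem.simple_commute (hR : IsRennerCoxeterSystem cs Λ) {e : R}
    (he : e ∈ Λ) {i j : B} (hi : i ∈ upperType cs e) (hj : j ∈ lowerType cs e) :
    cs.simple i * cs.simple j = cs.simple j * cs.simple i := by
  obtain ⟨I, hI⟩ := hR.stabilizer_parabolic e he
  have hmem : ∀ w : Rˣ, w ∈ parabolic cs I ↔ (w : R) * e = e * w ∧ (w : R) * e = e :=
    fun w => (Set.ext_iff.1 hI w).symm
  refine simple_commute_of_conj_mem_parabolic (I := I) (fun h => hi.2 ((hmem _).1 h).2)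
    ((hmem _).2 hj) ((hmem _).2 ?_)
  have h1 : (cs.simple j : R) * e = e := hj.2
  have h2 : e * (cs.simple j : R) = e := hj.1 ▸ hj.2
  have h3 : (cs.simple i : R) * (cs.simple i : R) = 1 := by
    rw [← Units.val_mul, cs.simple_mul_simple_self, Units.val_one]
  have hl : ((cs.simple i * cs.simple j * cs.simple i : Rˣ) : R) * e = e := by
    rw [Units.val_mul, Units.val_mul, mul_assoc, hi.1, ← mul_assoc, mul_assoc _ _ e, h1, hi.1,
      mul_assoc, h3, mul_one]
  have hr : e * ((cs.simple i * cs.simple j * cs.simple i : Rˣ) : R) = e := by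
    rw [Units.val_mul, Units.val_mul, ← mul_assoc, ← mul_assoc, ← hi.1, mul_assoc _ e, h2,
      mul_assoc, ← hi.1, ← mul_assoc, h3, one_mul]
  exact ⟨hl.trans hr.symm, hl⟩

theorem greenR_of_unit (c y : R) (v w : Rˣ) (h : c * v = y * w) : greenR c y := by
  have h1 : c = y * (w * (v⁻¹ : Rˣ)) := by rw [← mul_assoc, ← h]; simp
  have h2 : y = c * (v * (w⁻¹ : Rˣ)) := by rw [← mul_assoc, h]; simp
  ext z
  constructor
  · rintro ⟨b, rfl⟩
    exact ⟨w * (v⁻¹ : Rˣ) * b, by conv_lhs => rw [h1, mul_assoc]⟩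
  · rintro ⟨b, rfl⟩
    exact ⟨v * (w⁻¹ : Rˣ) * b, by conv_lhs => rw [h2, mul_assoc]⟩

theorem greenL_of_unit (c y : R) (v w : Rˣ) (h : v * c = w * y) : greenL c y := by
  have h1 : c = (v⁻¹ : Rˣ) * w * y := by rw [mul_assoc, ← h]; simp
  have h2 : y = (w⁻¹ : Rˣ) * v * c := by rw [mul_assoc, h]; simp
  ext z
  constructor
  · rintro ⟨b, rfl⟩
    exact ⟨b * ((v⁻¹ : Rˣ) * w), by conv_lhs => rw [h1, ← mul_assoc]⟩
  · rintro ⟨b, rfl⟩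
    exact ⟨b * ((w⁻¹ : Rˣ) * v), by conv_lhs => rw [h2, ← mul_assoc]⟩

theorem idemLE.eq_of_greenJ [Finite R] {e f : R} (hle : idemLE e f) (he : IsIdempotentElem e)
    {x y a b : Rˣ} (h : greenJ ((x : R) * e * y) ((a : R) * f * b)) : e = f := by
  have hm : (a : R) * f * b ∈ {z : R | ∃ c d : R, z = c * ((a : R) * f * b) * d} :=
    ⟨1, 1, by simp⟩
  rw [← h] at hm
  obtain ⟨c, d, hcd⟩ := hm
  refine hle.eq_of_mul_mul_eq he (p := (a⁻¹ : Rˣ) * c * x) (q := y * d * (b⁻¹ : Rˣ)) ?_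
  calc ((a⁻¹ : Rˣ) : R) * c * x * e * (y * d * (b⁻¹ : Rˣ))
      = ((a⁻¹ : Rˣ) : R) * (c * (x * e * y) * d) * (b⁻¹ : Rˣ) := by simp only [mul_assoc]
    _ = f := by rw [← hcd]; simp [mul_assoc]

end RennerCoxeter

/-! ### The interpolation theorem -/

theorem mainTheorem12 {B R : Type*} [Monoid R] [Finite R] {M : CoxeterMatrix B}
    (cs : CoxeterSystem M Rˣ) (Λ : Set R) (hR : IsRennerCoxeterSystem cs Λ)
    (r s : R) (hJ : greenJ r s) (hrs : adherenceLE cs Λ r s) :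
    ∃ t u : R,
      (adherenceLE cs Λ r t ∧ adherenceLE cs Λ t s) ∧
      (adherenceLE cs Λ r u ∧ adherenceLE cs Λ u s) ∧
      (greenR r t ∧ greenL t s) ∧ (greenL r u ∧ greenR u s) := by
  obtain ⟨x, e, y, a, f, b, hr, hs, hef, _, ⟨p, hp, q, hq, rfl⟩, hxa, hby⟩ := hrs
  obtain ⟨rfl, he, hx, hy⟩ := id hr
  obtain ⟨rfl, -, ha, hb⟩ := id hs
  obtain rfl := hef.eq_of_greenJ (hR.idem e he) hJ
  have hxd := mem_minReps_empty_left.1 hx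
  have had := mem_minReps_empty_left.1 ha
  have hbd := mem_minReps_empty_right.1 hb
  have hcomm : ∀ i ∈ upperType cs e, ∀ j ∈ lowerType cs e,
      cs.simple i * cs.simple j = cs.simple j * cs.simple i :=
    fun i hi j hj => hR.simple_commute he hi hj
  have hne : ∀ i ∈ upperType cs e, ∀ j ∈ lowerType cs e, cs.simple i ≠ cs.simple j :=
    fun i hi j hj => simple_ne_of_mem_upperType hi hj
  have hbl : ∀ i ∈ lowerType cs e, cs.length b < cs.length (cs.simple i * b) :=
    fun i hi => hbd i hi.1
  have hbu : ∀ i ∈ upperType cs e, cs.length b < cs.length (cs.simple i * b) :=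
    fun i hi => hbd i hi.1
  have hxap : bruhatLE cs x (a * p) := bruhatLE_of_le_mul hxd hq (by rwa [mul_assoc])
  -- By commutation p⁻¹b is still minimal in its coset W_{λ_*(e)} p⁻¹b, hence below q⁻¹p⁻¹b = w⁻¹b.
  have hpby : bruhatLE cs (p⁻¹ * b) y := by
    refine (bruhatLE_mul_left_of_mem_parabolic
      (length_lt_simple_mul_of_commute hcomm hne (inv_mem hp) hbl) (inv_mem hq)).trans ?_
    rwa [← mul_assoc, ← mul_inv_rev]
  obtain ⟨v, hv, hxv, hvb⟩ := exists_mul_bruhatLE hbu hp hxap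
  have hpe := commute_of_mem_parabolic_upperType hp
  have hve := commute_of_mem_parabolic_upperType hv
  have ht : IsLeftStandardForm cs Λ (((x * v : Rˣ) : R) * e * b) (x * v) e b :=
    ⟨rfl, he, mem_minReps_empty_left.2 (length_lt_mul_simple_of_commute hcomm hne hv hxd), hb⟩
  have hu : IsLeftStandardForm cs Λ (((a * p : Rˣ) : R) * e * y) (a * p) e y :=
    ⟨rfl, he, mem_minReps_empty_left.2 (length_lt_mul_simple_of_commute hcomm hne hp had), hy⟩
  -- The adherence witnesses are v⁻¹ for r ≤⁺ t, p for u ≤⁺ s, and 1 for the other two; each lies in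
  -- W_{λ^*(e)}.
  refine ⟨((x * v : Rˣ) : R) * e * b, ((a * p : Rˣ) : R) * e * y,
    ⟨⟨x, e, y, x * v, e, b, hr, ht, hef, v⁻¹, ⟨v⁻¹, inv_mem hv, 1, one_mem _, by simp⟩, ?_, ?_⟩,
      ⟨x * v, e, b, a, e, b, ht, hs, hef, 1, ⟨1, one_mem _, 1, one_mem _, by simp⟩, ?_, ?_⟩⟩,
    ⟨⟨x, e, y, a * p, e, y, hr, hu, hef, 1, ⟨1, one_mem _, 1, one_mem _, by simp⟩, ?_, ?_⟩,
      ⟨a * p, e, y, a, e, b, hu, hs, hef, p, ⟨p, hp, 1, one_mem _, by simp⟩, ?_, ?_⟩⟩,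
    ⟨?_, ?_⟩, ?_, ?_⟩
  · simpa using bruhatLE_refl x
  · simpa using hvb.trans hpby
  · simpa using hxv
  · simpa using bruhatLE_refl b
  · simpa using hxap
  · simpa using bruhatLE_refl y
  · exact bruhatLE_refl _
  · exact hpby
  · refine greenR_of_unit _ _ (y⁻¹ * v) b⁻¹ ?_
    simp [mul_assoc, hve]
  · refine greenL_of_unit _ _ (x * v)⁻¹ a⁻¹ ?_
    simp [mul_assoc]
  · refine greenL_of_unit _ _ x⁻¹ (a * p)⁻¹ ?_
    simp [mul_assoc]
  · refine greenR_of_unit _ _ y⁻¹ (b⁻¹ * p) ?_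
    simp [mul_assoc, hpe]
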